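/- **Setting.** Let $\mathcal X$ be a sample space with a $\sigma$-finite reference measure $\mathrm dz$, let $f_\theta$ ($\theta\in\mathbb R^d$) be probability densities with respect to $\mathrm dz$, fix $\theta_\star\in\mathbb R^d$, and let $Z\sim\mathbb P(\mathrm dz)=f_{\theta_\star}(z)\,\mathrm dz$, with expectation $\mathbb E$. Write $\|\cdot\|$ for the Euclidean norm, $\|\theta\|_0$ for the number of nonzero coordinates of $\theta$, $\|\theta\|_1=\sum_j|\theta_j|$, and $\|\theta\|_\infty=\max_j|\theta_j|$. *Prior.* For $\rho>0$ let $\Pi=\sum_{\delta\in\{0,1\}^d}\pi_\delta\,\Pi(\cdot\mid\delta)$ where, under $\Pi(\cdot\mid\delta)$, the coordinates are independent, $\theta_j=0$ if $\delta_j=0$, and $\theta_j$ has the Laplace density $\frac{\rho}{2}e^{-\rho|x|}$ if $\delta_j=1$. Assume (H2): $\pi_\delta=g_{\|\delta\|_0}\binom{d}{\|\delta\|_0}^{-1}$ for a probability distribution $(g_s)_{0\le s\le d}$ and constants $c_1,c_2>0$, $c_3\ge c_4>0$ with $$\frac{c_1}{d^{c_3}}g_{s-1}\le g_s\le\frac{c_2}{d^{c_4}}g_{s-1},\qquad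 s=1,\dots,d.$$ *Quasi-posterior.* Let $(\theta,z)\mapsto q_\theta(z)>0$ be jointly measurable with $0<\int q_\theta(z)\,\Pi(\mathrm d\theta)<\infty$ for $\mathrm dz$-almost every $z$, and such that $\theta\mapsto\log q_\theta(z)$ is concave and differentiable on $\mathbb R^d$ for every $z$. Put $\check\Pi(A\mid z)=\int_Aq_\theta(z)\,\Pi(\mathrm d\theta)\big/\int_{\mathbb R^d}q_\theta(z)\,\Pi(\mathrm d\theta)$ and $$\mathcal L_\theta(z)=\log q_\theta(z)-\log q_{\theta_\star}(z)-\langle\nabla\log q_{\theta_\star}(z),\theta-\theta_\star\rangle .$$ *Rate functions and cones.* A rate function is a continuous, strictly increasing $r:[0,\infty)\to[0,\infty)$ with $r(0)=0$ and $\lim_{x\downarrow0}r(x)/x=0$; $\phi_r(a)=\inf\{x>0: r(z)\ge az\text{ for all }z\ge x\}$ with $\inf\emptyset=+\infty$. A split cone is a nonempty (measurable) set $\Theta\subseteq\mathbb R^d$ closed under multiplication by scalars $t\ge0$ and under all sign changes of coordinates. Let $\Theta_\star=\{\theta:\theta_j=0\text{ whenever }\theta_{\star j}=0\}$ and $$\mathcal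 N=\Big\{\theta\ne0:\ \sum_{j:\theta_{\star j}=0}|\theta_j|\le7\sum_{j:\theta_{\star j}\ne0}|\theta_j|\Big\}.$$ *Events.* For $\Theta\subseteq\mathbb R^d$, $\lambda,L\ge0$ and a rate function $r$, let $$\mathcal E_0(\Theta,\lambda)=\{z:|\langle\nabla\log q_{\theta_\star}(z),u\rangle|\le\lambda/2\ \ \forall u\in\Theta,\ \|u\|=1\},$$ $$\hat{\mathcal E}_1(\Theta,L)=\{z:\mathcal L_\theta(z)\ge-\tfrac L2\|\theta-\theta_\star\|^2\ \ \forall\theta\in\theta_\star+\Theta\},\qquad \check{\mathcal E}_1(\Theta,r)=\{z:\mathcal L_\theta(z)\le-\tfrac12r(\|\theta-\theta_\star\|)\ \ \forall\theta\in\theta_\star+\Theta\}.$$ **Theorem.** In this setting let $s_\star=\|\theta_\star\|_0$ and suppose $d^{c_4}\ge8c_2$. Let $\bar\Theta\supseteq\Theta_\star$ be a split cone, $\bar L\ge0$, $\bar\lambda\ge0$, and $r$ a rate function such that $\bar\epsilon=\phi_r(2\bar\lambda)$ is finite. (1) Let $\mathcal E=\mathcal E_0(\mathbb R^d,\rho)\cap\hat{\mathcal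 E}_1(\Theta_\star,\bar L)\cap\check{\mathcal E}_1(\mathcal N,r)$. For every integer $k\ge0$, $$\mathbb E\big[\check\Pi(\{\theta:\|\theta\|_0\ge s_\star+k\}\mid Z)\big]\le\mathbb P[Z\notin\mathcal E]+2e^{a}\Big(4+\frac{4\bar L}{\rho^2}\Big)^{s_\star}\binom d{s_\star}\Big(\frac{4c_2}{d^{c_4}}\Big)^k,$$ where $a=-\frac12\inf_{x>0}\big[r(x)-4\rho\sqrt{s_\star}\,x\big]\in(-\infty,+\infty]$ if $\mathcal N\ne\emptyset$, and $a=0$ if $\mathcal N=\emptyset$. The same bound holds if, in the definition of $\mathcal E$, the event $\mathcal E_0(\mathbb R^d,\rho)$ is replaced by the larger event $\{z:\|\nabla\log q_{\theta_\star}(z)\|_\infty\le\rho/2\}$. (2) Let $\mathcal E=\mathcal E_0(\bar\Theta,\bar\lambda)\cap\hat{\mathcal E}_1(\Theta_\star,\bar L)\cap\check{\mathcal E}_1(\bar\Theta,r)$. For every $M_0>2$, $$\mathbb E\big[\check\Pi(\{\theta\in\theta_\star+\bar\Theta:\|\theta-\theta_\star\|>M_0\bar\epsilon\}\mid Z)\big]\le\mathbb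 P[Z\notin\mathcal E]+\sum_{j\ge1}D_je^{-\frac18r(jM_0\bar\epsilon/2)}+2\binom d{s_\star}\Big(\frac{d^{c_3}}{c_1}\Big)^{s_\star}\Big(1+\frac{\bar L}{\rho^2}\Big)^{s_\star}\sum_{j\ge1}e^{-\frac18r(jM_0\bar\epsilon/2)}e^{3\rho c_0jM_0\bar\epsilon},$$ where $D_j$ is the maximal number of points of $\{\theta\in\theta_\star+\bar\Theta:\|\theta-\theta_\star\|\le(j+1)M_0\bar\epsilon\}$ with pairwise distances at least $jM_0\bar\epsilon/2$, and $c_0=\sup_{u\in\bar\Theta}\sup_{v\in\bar\Theta,\|v\|=1}|\langle\operatorname{sign}(u),v\rangle|$ (sign taken coordinatewise). The right-hand sides may be $+\infty$. -/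

import Mathlib

open MeasureTheory Filter Topology
open scoped ENNReal

noncomputable section

namespace QuasiPosterior

/-- The parameter space `ℝ^d` with its Euclidean structure. -/
abbrev Param (d : ℕ) := EuclideanSpace ℝ (Fin d)

variable {d : ℕ} {X : Type*}

/-- The sparsity structure of `θ`: the set of coordinates where `θ` does not vanish. Elements of
`{0,1}^d` are represented throughout by the subset of coordinates where they equal `1`. -/
def sparsity (θ : Param d) : Finset (Fin d) :=
  Finset.univ.filter fun j => θ j ≠ 0

/-- `‖θ‖₀`, the number of nonzero coordinates. -/
def l0 (θ : Param d) : ℕ := (sparsity θ).card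

/-! ### The prior and the quasi-posterior -/

/-- The Laplace distribution on `ℝ` with density `(ρ/2) exp(-ρ|x|)`. -/
def laplace (ρ : ℝ) : Measure ℝ :=
  volume.withDensity fun x => ENNReal.ofReal (ρ / 2 * Real.exp (-ρ * |x|))

/-- The conditional prior `Π(dθ|δ)`: independent coordinates, Laplace on `δ`, Dirac at `0` off
`δ`. -/
def condPrior (ρ : ℝ) (δ : Finset (Fin d)) : Measure (Param d) :=
  (Measure.pi fun j : Fin d => if j ∈ δ then laplace ρ else Measure.dirac (0 : ℝ)).map
    (WithLp.toLp 2)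

/-- The spike-and-slab prior `Π(dθ) = ∑_δ π_δ Π(dθ|δ)`. -/
def prior (p : Finset (Fin d) → ℝ) (ρ : ℝ) : Measure (Param d) :=
  ∑ δ : Finset (Fin d), ENNReal.ofReal (p δ) • condPrior ρ δ

/-- The quasi-posterior `A ↦ ∫_A q_θ(z) Π(dθ) / ∫ q_θ(z) Π(dθ)`. -/
def quasiPosterior (Pr : Measure (Param d)) (q : Param d → X → ℝ) (z : X) :
    Measure (Param d) :=
  (∫⁻ θ, ENNReal.ofReal (q θ z) ∂Pr)⁻¹ •
    Pr.withDensity fun θ => ENNReal.ofReal (q θ z)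

/-- The law `P_θ(dz) = f_θ(z) dz`, with `ν` the reference measure `dz`. -/
def law [MeasurableSpace X] (ν : Measure X) (f : Param d → X → ℝ) (θ : Param d) : Measure X :=
  ν.withDensity fun z => ENNReal.ofReal (f θ z)

/-- `f θ` is a probability density with respect to `ν`, for every `θ`. -/
def IsDensityFamily [MeasurableSpace X] (ν : Measure X) (f : Param d → X → ℝ) : Prop :=
  ∀ θ, Measurable (f θ) ∧ (∀ z, 0 ≤ f θ z) ∧ ∫⁻ z, ENNReal.ofReal (f θ z) ∂ν = 1

/-- `q` is an admissible quasi-likelihood for the prior `Pr`: positive, jointly measurable, with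
positive and finite normalizing constant for almost every `z`. -/
structure IsQuasiLikelihood [MeasurableSpace X] (ν : Measure X) (Pr : Measure (Param d))
    (q : Param d → X → ℝ) : Prop where
  pos : ∀ θ z, 0 < q θ z
  measurable : Measurable fun w : Param d × X => q w.1 w.2
  normalizable : ∀ᵐ z ∂ν, 0 < ∫⁻ θ, ENNReal.ofReal (q θ z) ∂Pr ∧
    ∫⁻ θ, ENNReal.ofReal (q θ z) ∂Pr < ∞

/-- For every `z`, the map `θ ↦ log q_θ(z)` is concave and differentiable. -/
def IsLogConcaveSmooth (q : Param d → X → ℝ) : Prop :=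
  ∀ z, ConcaveOn ℝ Set.univ (fun θ => Real.log (q θ z)) ∧
    Differentiable ℝ fun θ => Real.log (q θ z)

/-- The condition on the prior weights: `π_δ = g_{‖δ‖₀} / C(d, ‖δ‖₀)` for a probability
distribution `g` on `{0, …, d}` with `c₁ d^{-c₃} g_{s-1} ≤ g_s ≤ c₂ d^{-c₄} g_{s-1}`. -/
structure IsSparsePrior (p : Finset (Fin d) → ℝ) (g : ℕ → ℝ) (c₁ c₂ c₃ c₄ : ℝ) : Prop where
  c₁_pos : 0 < c₁
  c₂_pos : 0 < c₂
  c₄_pos : 0 < c₄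
  c₄_le : c₄ ≤ c₃
  nonneg : ∀ s ≤ d, 0 ≤ g s
  sum_one : ∑ s ∈ Finset.range (d + 1), g s = 1
  weight : ∀ δ, p δ = g δ.card / (d.choose δ.card : ℝ)
  lower : ∀ s, 1 ≤ s → s ≤ d → c₁ / (d : ℝ) ^ c₃ * g (s - 1) ≤ g s
  upper : ∀ s, 1 ≤ s → s ≤ d → g s ≤ c₂ / (d : ℝ) ^ c₄ * g (s - 1)

/-! ### Curvature, rate functions, cones -/

/-- `∇ log q_{θ⋆}(z)`. -/
def score (q : Param d → X → ℝ) (θs : Param d) (z : X) : Param d :=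
  gradient (fun θ => Real.log (q θ z)) θs

/-- `L_θ(z) = log q_θ(z) - log q_{θ⋆}(z) - ⟨∇ log q_{θ⋆}(z), θ - θ⋆⟩`. -/
def bregman (q : Param d → X → ℝ) (θs θ : Param d) (z : X) : ℝ :=
  Real.log (q θ z) - Real.log (q θs z) - inner ℝ (score q θs z) (θ - θs)

/-- Rate functions; only the values of `r` on `[0, ∞)` matter. -/
structure IsRateFunction (r : ℝ → ℝ) : Prop where
  continuousOn : ContinuousOn r (Set.Ici 0)
  strictMonoOn : StrictMonoOn r (Set.Ici 0)
  zero : r 0 = 0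
  tendsto : Tendsto (fun x => r x / x) (𝓝[>] 0) (𝓝 0)

/-- `φ_r(a) = inf {x > 0 : r(z) ≥ a z for all z ≥ x}`, equal to `∞` if the set is empty. -/
def rateInv (r : ℝ → ℝ) (a : ℝ) : ℝ≥0∞ :=
  ⨅ (x : ℝ) (_ : 0 < x ∧ ∀ z, x ≤ z → a * z ≤ r z), ENNReal.ofReal x

/-- Split cones: nonempty cones that are invariant under all changes of signs of coordinates. -/
structure IsSplitCone (Θ : Set (Param d)) : Prop where
  nonempty : Θ.Nonempty
  smul_mem : ∀ t : ℝ, 0 ≤ t → ∀ x ∈ Θ, t • x ∈ Θ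
  sign_mem : ∀ u : Fin d → ℝ, (∀ j, u j = 1 ∨ u j = -1) →
    ∀ x ∈ Θ, WithLp.toLp 2 (fun j => u j * x j) ∈ Θ

/-- `Θ⋆`, the vectors that vanish wherever `θ⋆` vanishes. -/
def starCone (θs : Param d) : Set (Param d) :=
  {θ | ∀ j, θs j = 0 → θ j = 0}

/-- The set `𝒩` of nonzero `θ` with `∑_{j ∉ supp θ⋆} |θ_j| ≤ 7 ∑_{j ∈ supp θ⋆} |θ_j|`. -/
def coneN (θs : Param d) : Set (Param d) :=
  {θ | θ ≠ 0 ∧ ∑ j ∈ (sparsity θs)ᶜ, |θ j| ≤ 7 * ∑ j ∈ sparsity θs, |θ j|}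

/-! ### Good events -/

/-- `Ě₁(Θ, r)`. -/
def eventUpper (q : Param d → X → ℝ) (θs : Param d) (Θ : Set (Param d)) (r : ℝ → ℝ) : Set X :=
  {z | ∀ v ∈ Θ, bregman q θs (θs + v) z ≤ -(1 / 2) * r ‖v‖}

/-- `Ê₁(Θ, L)`. -/
def eventLower (q : Param d → X → ℝ) (θs : Param d) (Θ : Set (Param d)) (L : ℝ) : Set X :=
  {z | ∀ v ∈ Θ, -(L / 2) * ‖v‖ ^ 2 ≤ bregman q θs (θs + v) z}

/-- `E₀(Θ, lam)`: `|⟨∇ log q_{θ⋆}(z), u⟩| ≤ lam/2` for all unit vectors `u` of `Θ`. -/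
def eventScore (q : Param d → X → ℝ) (θs : Param d) (Θ : Set (Param d)) (lam : ℝ) : Set X :=
  {z | ∀ u ∈ Θ, ‖u‖ = 1 → |inner ℝ (score q θs z) u| ≤ lam / 2}

/-- `{z : ‖∇ log q_{θ⋆}(z)‖_∞ ≤ lam/2}`. -/
def eventScoreSup (q : Param d → X → ℝ) (θs : Param d) (lam : ℝ) : Set X :=
  {z | ∀ j, |score q θs z j| ≤ lam / 2}

/-! ### Quantities in the bounds -/

/-- `B(Θ, M) = {θ ∈ θ⋆ + Θ : ‖θ - θ⋆‖ ≤ M}`. -/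
def coneBall (θs : Param d) (Θ : Set (Param d)) (M : ℝ) : Set (Param d) :=
  {θ | θ - θs ∈ Θ ∧ ‖θ - θs‖ ≤ M}

/-- The `ε`-packing number: the maximal number of points of `B` with pairwise distances at least
`ε`. -/
def packing (ε : ℝ) (B : Set (Param d)) : ℕ∞ :=
  ⨆ (F : Finset (Param d)) (_ : (F : Set (Param d)) ⊆ B ∧
    (F : Set (Param d)).Pairwise fun x y => ε ≤ dist x y), (F.card : ℕ∞)

/-- `a = -(1/2) inf_{x > 0} [r(x) - 4 ρ √s⋆ x]` if `𝒩 ≠ ∅`, and `a = 0` otherwise. The infimum may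
be `-∞`, and then `a = +∞`. -/
def expoA (θs : Param d) (ρ : ℝ) (r : ℝ → ℝ) : EReal :=
  open Classical in
  if (coneN θs).Nonempty then
    ((-(1 / 2) : ℝ) : EReal) *
      ⨅ (x : ℝ) (_ : 0 < x), ((r x - 4 * ρ * Real.sqrt (l0 θs) * x : ℝ) : EReal)
  else 0

/-- `c₀ = sup_{u ∈ Θ} sup_{v ∈ Θ, ‖v‖ = 1} |⟨sign u, v⟩|`; the set is bounded by `√d`. -/
def coneConst (Θ : Set (Param d)) : ℝ :=
  sSup {t | ∃ u ∈ Θ, ∃ v ∈ Θ, ‖v‖ = 1 ∧ t = |∑ j, Real.sign (u j) * v j|}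

end QuasiPosterior

end

noncomputable section

namespace QuasiPosterior

variable {d : ℕ} {X : Type*}

/-! The quasi-posterior mass of a set is a ratio of two prior integrals, and on the good event each
is controlled directly, without tests or a covering argument. Write v = θ - θ⋆.

Denominator (`le_normalizer`): keep only the model supported exactly where θ⋆ is. There the
curvature bound puts q_θ above q_θ⋆ times a Gaussian factor with a linear tilt by the score.
Recentring the Laplace law costs e^{-ρ‖θ⋆‖₁}, the tilt disappears by symmetry, and each active
coordinate leaves a factor at least (1 + L/ρ²)⁻¹.

Numerator (`quasiPosterior_le`): if q_θ / q_θ⋆ is at most B exp(-ρ‖θ⋆‖₁ + ρ‖θ‖₁ - κρ‖v‖₁), the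
Laplace density is traded for one centred at θ⋆ of scale κρ, so a model δ contributes at most B
κ^{-|δ|}. The geometric decay of g absorbs κ^{-|δ|}, and e^{-ρ‖θ⋆‖₁} cancels in the ratio.

It remains to find B. For sparsity (`exists_exponent_le`), κ = 1/4: outside the cone 𝒩 concavity
suffices with B = 1, and inside it the rate r competes with a term linear in ‖v‖, giving e^a. For
contraction (`quasiPosterior_dist_le`), κ = 1/2: beyond the radius ε̄ the rate dominates the score,
and B is a sum over shells. Outside the good event the mass is bounded by 1. -/

/-- The `ℓ¹` norm of a parameter. -/
def l1 (θ : Param d) : ℝ := ∑ j, |θ j|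

/-! ### One-dimensional integrals -/

lemma lintegral_exp_neg_mul_abs {a : ℝ} (ha : 0 < a) :
    ∫⁻ x : ℝ, ENNReal.ofReal (Real.exp (-a * |x|)) = ENNReal.ofReal (2 / a) := by
  have h : ∫ x : ℝ, Real.exp (-a * |x|) = 2 / a := by
    rw [integral_comp_abs (f := fun x => Real.exp (-a * x)),
      integral_exp_mul_Ioi (by linarith) 0]
    simp [div_eq_mul_inv]
  rw [← h, ofReal_integral_eq_lintegral_ofReal]
  · refine Integrable.of_integral_ne_zero ?_
    rw [h]; positivity
  · exact Eventually.of_forall fun x => (Real.exp_pos _).le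

lemma measurable_laplaceDensity (ρ : ℝ) :
    Measurable fun x : ℝ => ENNReal.ofReal (ρ / 2 * Real.exp (-ρ * |x|)) := by
  fun_prop

lemma lintegral_laplace (ρ : ℝ) {F : ℝ → ℝ≥0∞} (hF : Measurable F) :
    ∫⁻ x, F x ∂laplace ρ = ∫⁻ x, ENNReal.ofReal (ρ / 2 * Real.exp (-ρ * |x|)) * F x := by
  rw [laplace, lintegral_withDensity_eq_lintegral_mul _ (measurable_laplaceDensity ρ) hF]
  rfl

lemma isProbabilityMeasure_laplace {ρ : ℝ} (hρ : 0 < ρ) : IsProbabilityMeasure (laplace ρ) := by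
  constructor
  have h := lintegral_laplace ρ (measurable_const (a := (1 : ℝ≥0∞)))
  simp only [lintegral_const, one_mul, mul_one] at h
  rw [h]
  simp_rw [ENNReal.ofReal_mul (half_pos hρ).le]
  rw [lintegral_const_mul _ (by fun_prop), lintegral_exp_neg_mul_abs hρ,
    ← ENNReal.ofReal_mul (half_pos hρ).le]
  rw [show ρ / 2 * (2 / ρ) = 1 by field_simp]
  simp

/-- Changing the Laplace density into one centred at `m` with scale `κ ρ`. -/
lemma lintegral_laplace_tilt {ρ κ : ℝ} (hρ : 0 < ρ) (hκ : 0 < κ) (m : ℝ) :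
    ∫⁻ x, ENNReal.ofReal (Real.exp (ρ * |x| - κ * ρ * |x - m|)) ∂laplace ρ =
      ENNReal.ofReal κ⁻¹ := by
  rw [lintegral_laplace ρ (by fun_prop)]
  have h : ∀ x : ℝ, ENNReal.ofReal (ρ / 2 * Real.exp (-ρ * |x|)) *
      ENNReal.ofReal (Real.exp (ρ * |x| - κ * ρ * |x - m|)) =
      ENNReal.ofReal (ρ / 2) * ENNReal.ofReal (Real.exp (-(κ * ρ) * |x - m|)) := by
    intro x
    rw [ENNReal.ofReal_mul (half_pos hρ).le, mul_assoc, ← ENNReal.ofReal_mul (Real.exp_pos _).le,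
      ← Real.exp_add]
    ring_nf
  simp_rw [h]
  rw [lintegral_const_mul _ (by fun_prop),
    lintegral_sub_right_eq_self (fun x => ENNReal.ofReal (Real.exp (-(κ * ρ) * |x|))) m,
    lintegral_exp_neg_mul_abs (mul_pos hκ hρ), ← ENNReal.ofReal_mul (half_pos hρ).le]
  congr 1
  field_simp

/-- A Mills-type lower bound for the Laplace transform of a Gaussian on the half-line. -/
lemma le_lintegral_Ioi_exp_neg_sq {ρ L : ℝ} (hρ : 0 < ρ) (hL : 0 ≤ L) :
    ENNReal.ofReal (1 + L / ρ ^ 2)⁻¹ ≤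
      ∫⁻ x in Set.Ioi (0 : ℝ), ENNReal.ofReal (ρ * Real.exp (-ρ * x - L / 2 * x ^ 2)) := by
  rcases hL.eq_or_lt with rfl | hL
  · have h : ∫ x in Set.Ioi (0 : ℝ), ρ * Real.exp (-ρ * x) = 1 := by
      rw [integral_const_mul, integral_exp_mul_Ioi (by linarith) 0]
      simp [hρ.ne']
    have hi : IntegrableOn (fun x => ρ * Real.exp (-ρ * x)) (Set.Ioi (0 : ℝ)) :=
      Integrable.of_integral_ne_zero (by rw [h]; exact one_ne_zero)
    simp only [zero_div, add_zero, inv_one, zero_mul, sub_zero]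
    rw [← h, ofReal_integral_eq_lintegral_ofReal hi]
    exact Eventually.of_forall fun x => by positivity
  · set A : ℝ := (1 + L / ρ ^ 2)⁻¹ with hA
    have hA0 : 0 < A := by positivity
    set T : ℝ := ρ / L with hT
    have hT0 : 0 < T := by positivity
    set h : ℝ → ℝ := fun x => ρ * Real.exp (-ρ * x - L / 2 * x ^ 2) with hh
    have hhc : Continuous h := by fun_prop
    -- The comparison function `G'` has primitive -A(1 - Lx/ρ)exp(-ρx - Lx²/2). The linear factor is
    -- chosen to cancel the term of order x, and A so that the constant term is ρ; hence `G'` lies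
    -- below the integrand. The primitive vanishes at T = ρ/L and is -A at 0.
    set G' : ℝ → ℝ := fun x => (ρ - A * (L ^ 2 / ρ) * x ^ 2) *
      Real.exp (-ρ * x - L / 2 * x ^ 2) with hG'
    have hderiv : ∀ x : ℝ, HasDerivAt
        (fun x => -(A * (1 - L / ρ * x) * Real.exp (-ρ * x - L / 2 * x ^ 2))) (G' x) x := by
      intro x
      have h1 : HasDerivAt (fun x : ℝ => A * (1 - L / ρ * x)) (A * (-(L / ρ))) x := by
        simpa using (((hasDerivAt_id x).const_mul (L / ρ)).const_sub 1).const_mul A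
      have h2 : HasDerivAt (fun x : ℝ => -ρ * x - L / 2 * x ^ 2) (-ρ - L * x) x := by
        refine (((hasDerivAt_id x).const_mul (-ρ)).sub
          ((hasDerivAt_pow 2 x).const_mul (L / 2))).congr_deriv ?_
        push_cast
        ring
      refine (h1.mul h2.exp).neg.congr_deriv ?_
      have hAe : A * (1 + L / ρ ^ 2) = 1 := by rw [hA]; field_simp
      have hAρ : A * (ρ + L / ρ) = ρ := by
        calc A * (ρ + L / ρ) = ρ * (A * (1 + L / ρ ^ 2)) := by field_simp
          _ = ρ := by rw [hAe, mul_one]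
      simp only [hG']
      rw [show ρ - A * (L ^ 2 / ρ) * x ^ 2 = A * (ρ + L / ρ) - A * (L ^ 2 / ρ) * x ^ 2 by rw [hAρ]]
      field_simp
      ring
    have hint : ∫ x in (0 : ℝ)..T, G' x = A := by
      rw [intervalIntegral.integral_eq_sub_of_hasDerivAt (fun x _ => hderiv x)]
      · have : 1 - L / ρ * T = 0 := by rw [hT]; field_simp; ring
        simp [this]
      · exact (by fun_prop : Continuous G').intervalIntegrable _ _
    have hle : A ≤ ∫ x in (0 : ℝ)..T, h x := by
      rw [← hint]
      refine intervalIntegral.integral_mono_on hT0.le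
        ((by fun_prop : Continuous G').intervalIntegrable _ _) (hhc.intervalIntegrable _ _) ?_
      intro x _
      refine mul_le_mul_of_nonneg_right ?_ (Real.exp_pos _).le
      have : 0 ≤ A * (L ^ 2 / ρ) * x ^ 2 := by positivity
      linarith
    rw [intervalIntegral.integral_of_le hT0.le] at hle
    calc ENNReal.ofReal A ≤ ENNReal.ofReal (∫ x in Set.Ioc 0 T, h x) := ENNReal.ofReal_le_ofReal hle
      _ = ∫⁻ x in Set.Ioc 0 T, ENNReal.ofReal (h x) := by
        refine ofReal_integral_eq_lintegral_ofReal ?_ ?_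
        · exact (hhc.integrableOn_Icc).mono_set Set.Ioc_subset_Icc_self
        · exact Eventually.of_forall fun x => by simp only [hh]; positivity
      _ ≤ _ := lintegral_mono_set fun x hx => hx.1

/-- Lower bound for the Laplace integral of a Gaussian factor with an arbitrary linear tilt. -/
lemma le_lintegral_laplace_gaussian {ρ L : ℝ} (hρ : 0 < ρ) (hL : 0 ≤ L) (b m : ℝ) :
    ENNReal.ofReal (Real.exp (-ρ * |m|) * (1 + L / ρ ^ 2)⁻¹) ≤
      ∫⁻ x, ENNReal.ofReal (Real.exp (b * (x - m) - L / 2 * (x - m) ^ 2)) ∂laplace ρ := by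
  set F : ℝ → ℝ := fun v => ρ / 2 * Real.exp (-ρ * |v| + b * v - L / 2 * v ^ 2) with hF
  have hFm : Measurable fun v => ENNReal.ofReal (F v) := by fun_prop
  rw [lintegral_laplace ρ (by fun_prop), ENNReal.ofReal_mul (Real.exp_pos _).le]
  -- Recentring at m: |x| ≤ |x - m| + |m| costs exp(-ρ|m|), after which Lebesgue measure is
  -- translation invariant.
  have hshift : ∀ x : ℝ, ENNReal.ofReal (Real.exp (-ρ * |m|)) * ENNReal.ofReal (F (x - m)) ≤
      ENNReal.ofReal (ρ / 2 * Real.exp (-ρ * |x|)) *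
        ENNReal.ofReal (Real.exp (b * (x - m) - L / 2 * (x - m) ^ 2)) := by
    intro x
    rw [← ENNReal.ofReal_mul (Real.exp_pos _).le, ← ENNReal.ofReal_mul (by positivity)]
    refine ENNReal.ofReal_le_ofReal ?_
    have h1 : |x| ≤ |x - m| + |m| := by simpa using abs_add_le (x - m) m
    calc Real.exp (-ρ * |m|) * F (x - m)
        = ρ / 2 * Real.exp (-ρ * (|x - m| + |m|) + (b * (x - m) - L / 2 * (x - m) ^ 2)) := by
          simp only [hF]
          rw [mul_left_comm, ← Real.exp_add]
          ring_nf
      _ ≤ ρ / 2 * Real.exp (-ρ * |x| + (b * (x - m) - L / 2 * (x - m) ^ 2)) := by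
          have : ρ * |x| ≤ ρ * (|x - m| + |m|) := by gcongr
          gcongr ρ / 2 * Real.exp (?_ + _)
          linarith
      _ = _ := by rw [Real.exp_add]; ring
  refine le_trans ?_ (lintegral_mono hshift)
  rw [lintegral_const_mul _ (by fun_prop),
    lintegral_sub_right_eq_self (fun x => ENNReal.ofReal (F x)) m]
  gcongr
  have hneg : ∫⁻ x in Set.Iic (0 : ℝ), ENNReal.ofReal (F x) =
      ∫⁻ x in Set.Ioi (0 : ℝ), ENNReal.ofReal (F (-x)) := by
    have h := (Measure.measurePreserving_neg (volume : Measure ℝ)).setLIntegral_comp_preimage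
      (measurableSet_Iic (a := (0 : ℝ))) hFm
    rw [← h]
    simp only [Set.neg_preimage, Set.neg_Iic, neg_zero]
    exact setLIntegral_congr Ioi_ae_eq_Ici.symm
  -- Folding the line onto the half-line turns the tilt by b into a factor cosh(bx) ≥ 1, so b drops
  -- out.
  have hsplit : ∫⁻ x, ENNReal.ofReal (F x) =
      ∫⁻ x in Set.Ioi (0 : ℝ), (ENNReal.ofReal (F x) + ENNReal.ofReal (F (-x))) := by
    rw [lintegral_add_left hFm, ← hneg, ← lintegral_add_compl _ (measurableSet_Ioi (a := (0 : ℝ))),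
      Set.compl_Ioi]
  rw [hsplit]
  refine (le_lintegral_Ioi_exp_neg_sq hρ hL).trans (setLIntegral_mono (by fun_prop) ?_)
  intro x hx
  have hx0 : 0 < x := hx
  rw [← ENNReal.ofReal_add (by positivity) (by positivity)]
  refine ENNReal.ofReal_le_ofReal ?_
  have hcosh := Real.one_le_cosh (b * x)
  have e : F x + F (-x) = ρ * Real.exp (-ρ * x - L / 2 * x ^ 2) * Real.cosh (b * x) := by
    simp only [hF, abs_neg, abs_of_pos hx0, Real.cosh_eq]
    rw [show -ρ * x + b * x - L / 2 * x ^ 2 = (-ρ * x - L / 2 * x ^ 2) + b * x by ring,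
      show -ρ * x + b * -x - L / 2 * (-x) ^ 2 = (-ρ * x - L / 2 * x ^ 2) + -(b * x) by ring,
      Real.exp_add, Real.exp_add]
    ring
  rw [e]
  exact le_mul_of_one_le_right (by positivity) hcosh

/-! ### Integrals against the conditional prior -/

lemma isProbabilityMeasure_slab {ρ : ℝ} (hρ : 0 < ρ) (δ : Finset (Fin d)) (j : Fin d) :
    IsProbabilityMeasure (if j ∈ δ then laplace ρ else Measure.dirac (0 : ℝ)) := by
  split_ifs
  · exact isProbabilityMeasure_laplace hρ
  · infer_instance

lemma isProbabilityMeasure_condPrior {ρ : ℝ} (hρ : 0 < ρ) (δ : Finset (Fin d)) :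
    IsProbabilityMeasure (condPrior ρ δ) := by
  have := isProbabilityMeasure_slab hρ δ
  exact Measure.isProbabilityMeasure_map (by fun_prop)

lemma lintegral_pi_prod {ι : Type*} [Fintype ι] {Ω : ι → Type*} [∀ i, MeasurableSpace (Ω i)]
    (μ : ∀ i, Measure (Ω i)) [∀ i, IsProbabilityMeasure (μ i)] {F : ∀ i, Ω i → ℝ≥0∞}
    (hF : ∀ i, Measurable (F i)) :
    ∫⁻ x, ∏ i, F i (x i) ∂Measure.pi μ = ∏ i, ∫⁻ x, F i x ∂μ i := by
  have hind := ProbabilityTheory.iIndepFun_pi (μ := μ) (X := F) fun i => (hF i).aemeasurable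
  rw [ProbabilityTheory.lintegral_prod_eq_prod_lintegral_of_indepFun Finset.univ
    (fun i (x : ∀ i, Ω i) => F i (x i)) hind fun i => (hF i).comp (measurable_pi_apply i)]
  refine Finset.prod_congr rfl fun i _ => ?_
  exact (measurePreserving_eval μ i).lintegral_comp (hF i)

lemma lintegral_condPrior_prod {ρ : ℝ} (hρ : 0 < ρ) (δ : Finset (Fin d)) {F : Fin d → ℝ → ℝ≥0∞}
    (hF : ∀ j, Measurable (F j)) :
    ∫⁻ θ, ∏ j, F j (θ j) ∂condPrior ρ δ =
      ∏ j, if j ∈ δ then ∫⁻ x, F j x ∂laplace ρ else F j 0 := by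
  have := isProbabilityMeasure_slab hρ δ
  rw [condPrior, lintegral_map (by fun_prop) (by fun_prop)]
  rw [lintegral_pi_prod _ hF]
  refine Finset.prod_congr rfl fun j _ => ?_
  split_ifs
  · rfl
  · exact lintegral_dirac' _ (hF j)

lemma ae_condPrior_eq_zero {ρ : ℝ} (hρ : 0 < ρ) (δ : Finset (Fin d)) :
    ∀ᵐ θ ∂condPrior ρ δ, ∀ j ∉ δ, θ j = 0 := by
  have := isProbabilityMeasure_slab hρ δ
  rw [ae_all_iff]
  intro j
  by_cases hj : j ∈ δ
  · simp [hj]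
  simp only [hj, not_false_eq_true, forall_const]
  rw [condPrior, ae_map_iff (by fun_prop) (by measurability)]
  have h := measurePreserving_eval
    (fun j : Fin d => if j ∈ δ then laplace ρ else Measure.dirac (0 : ℝ)) j
  refine h.quasiMeasurePreserving.ae (p := fun x => x = 0) ?_
  simp only [hj, if_false]
  exact (ae_dirac_iff (measurableSet_singleton (0 : ℝ))).2 rfl

lemma l0_le_card_of_ae {δ : Finset (Fin d)} {θ : Param d} (h : ∀ j ∉ δ, θ j = 0) :
    l0 θ ≤ δ.card := by
  refine Finset.card_le_card fun j hj => ?_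
  by_contra hjδ
  exact (Finset.mem_filter.1 hj).2 (h j hjδ)

/-- The exponent is a sum over coordinates, so the integral factors: a slab coordinate gives exactly
κ⁻¹ after recentring, a spike coordinate at most 1. -/
lemma lintegral_condPrior_exp_le {ρ κ : ℝ} (hρ : 0 < ρ) (hκ : 0 < κ) (δ : Finset (Fin d))
    (θs : Param d) :
    ∫⁻ θ, ENNReal.ofReal (Real.exp (ρ * l1 θ - κ * ρ * l1 (θ - θs))) ∂condPrior ρ δ ≤
      ENNReal.ofReal (κ⁻¹ ^ δ.card) := by
  have h : ∀ θ : Param d, ENNReal.ofReal (Real.exp (ρ * l1 θ - κ * ρ * l1 (θ - θs))) =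
      ∏ j, ENNReal.ofReal (Real.exp (ρ * |θ j| - κ * ρ * |θ j - θs j|)) := by
    intro θ
    rw [← ENNReal.ofReal_prod_of_nonneg fun j _ => (Real.exp_pos _).le, ← Real.exp_sum,
      Finset.sum_sub_distrib, ← Finset.mul_sum, ← Finset.mul_sum]
    rfl
  simp_rw [h]
  rw [lintegral_condPrior_prod hρ δ
    (F := fun j x => ENNReal.ofReal (Real.exp (ρ * |x| - κ * ρ * |x - θs j|)))
    (fun j => by fun_prop)]
  have : ENNReal.ofReal (κ⁻¹ ^ δ.card) = ∏ j, if j ∈ δ then ENNReal.ofReal κ⁻¹ else 1 := by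
    rw [Finset.prod_ite_mem, Finset.univ_inter, Finset.prod_const,
      ENNReal.ofReal_pow (by positivity)]
  rw [this]
  refine Finset.prod_le_prod' fun j _ => ?_
  split_ifs
  · rw [lintegral_laplace_tilt hρ hκ]
  · rw [ENNReal.ofReal_le_one, Real.exp_le_one_iff]
    have : 0 ≤ κ * ρ * |0 - θs j| := by positivity
    simp only [abs_zero, mul_zero]
    linarith

lemma le_lintegral_condPrior_gaussian {ρ L : ℝ} (hρ : 0 < ρ) (hL : 0 ≤ L) (b θs : Param d) :
    ENNReal.ofReal (Real.exp (-ρ * l1 θs) * (1 + L / ρ ^ 2)⁻¹ ^ l0 θs) ≤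
      ∫⁻ θ, ENNReal.ofReal (Real.exp (inner ℝ b (θ - θs) - L / 2 * ‖θ - θs‖ ^ 2))
        ∂condPrior ρ (sparsity θs) := by
  have h : ∀ θ : Param d,
      ENNReal.ofReal (Real.exp (inner ℝ b (θ - θs) - L / 2 * ‖θ - θs‖ ^ 2)) =
      ∏ j, ENNReal.ofReal (Real.exp (b j * (θ j - θs j) - L / 2 * (θ j - θs j) ^ 2)) := by
    intro θ
    rw [← ENNReal.ofReal_prod_of_nonneg fun j _ => (Real.exp_pos _).le, ← Real.exp_sum,
      Finset.sum_sub_distrib, ← Finset.mul_sum, EuclideanSpace.real_norm_sq_eq, PiLp.inner_apply]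
    simp [mul_comm]
  simp_rw [h]
  rw [lintegral_condPrior_prod hρ (sparsity θs)
    (F := fun j x => ENNReal.ofReal (Real.exp (b j * (x - θs j) - L / 2 * (x - θs j) ^ 2)))
    (fun j => by fun_prop)]
  have : ENNReal.ofReal (Real.exp (-ρ * l1 θs) * (1 + L / ρ ^ 2)⁻¹ ^ l0 θs) =
      ∏ j, if j ∈ sparsity θs then
        ENNReal.ofReal (Real.exp (-ρ * |θs j|) * (1 + L / ρ ^ 2)⁻¹) else 1 := by
    rw [Finset.prod_ite_mem, Finset.univ_inter,
      ← ENNReal.ofReal_prod_of_nonneg fun j _ => by positivity, Finset.prod_mul_distrib,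
      Finset.prod_const, ← Real.exp_sum, ← Finset.mul_sum, l1, l0]
    congr 4
    symm
    refine Finset.sum_subset (Finset.subset_univ _) fun j _ hj => ?_
    simpa [sparsity] using hj
  rw [this]
  refine Finset.prod_le_prod' fun j _ => ?_
  split_ifs with hj
  · exact le_lintegral_laplace_gaussian hρ hL _ _
  -- Off the support both θ and θ⋆ vanish, so the factor is 1 whatever the tilt.
  · have : θs j = 0 := by simpa [sparsity] using hj
    simp [this]

/-! ### The prior weights -/

section Weights

variable {p : Finset (Fin d) → ℝ} {g : ℕ → ℝ} {c₁ c₂ c₃ c₄ : ℝ}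

lemma IsSparsePrior.dim_pos (H : IsSparsePrior p g c₁ c₂ c₃ c₄) (hd : 8 * c₂ ≤ (d : ℝ) ^ c₄) :
    0 < d := by
  rcases Nat.eq_zero_or_pos d with rfl | h
  · have := H.c₂_pos
    rw [Nat.cast_zero, Real.zero_rpow H.c₄_pos.ne'] at hd
    linarith
  · exact h

lemma IsSparsePrior.ratio_nonneg (H : IsSparsePrior p g c₁ c₂ c₃ c₄) : 0 ≤ c₂ / (d : ℝ) ^ c₄ :=
  div_nonneg H.c₂_pos.le (by positivity)

lemma IsSparsePrior.ratio_le (H : IsSparsePrior p g c₁ c₂ c₃ c₄) (hd : 8 * c₂ ≤ (d : ℝ) ^ c₄) :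
    c₂ / (d : ℝ) ^ c₄ ≤ 1 / 8 := by
  have h : 0 < (d : ℝ) ^ c₄ := by
    have := H.c₂_pos
    linarith
  rw [div_le_div_iff₀ h (by norm_num)]
  linarith

lemma IsSparsePrior.le_pow_mul (H : IsSparsePrior p g c₁ c₂ c₃ c₄) (s n : ℕ) (h : s + n ≤ d) :
    g (s + n) ≤ (c₂ / (d : ℝ) ^ c₄) ^ n * g s := by
  induction n with
  | zero => simp
  | succ n ih =>
    calc g (s + (n + 1)) ≤ c₂ / (d : ℝ) ^ c₄ * g (s + n) := by
          simpa using H.upper (s + (n + 1)) (by omega) h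
      _ ≤ c₂ / (d : ℝ) ^ c₄ * ((c₂ / (d : ℝ) ^ c₄) ^ n * g s) :=
          mul_le_mul_of_nonneg_left (ih (by omega)) H.ratio_nonneg
      _ = _ := by ring

lemma IsSparsePrior.pow_mul_le (H : IsSparsePrior p g c₁ c₂ c₃ c₄) (s : ℕ) (h : s ≤ d) :
    (c₁ / (d : ℝ) ^ c₃) ^ s * g 0 ≤ g s := by
  induction s with
  | zero => simp
  | succ n ih =>
    have h0 : 0 ≤ c₁ / (d : ℝ) ^ c₃ := div_nonneg H.c₁_pos.le (by positivity)
    calc (c₁ / (d : ℝ) ^ c₃) ^ (n + 1) * g 0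
        = c₁ / (d : ℝ) ^ c₃ * ((c₁ / (d : ℝ) ^ c₃) ^ n * g 0) := by ring
      _ ≤ c₁ / (d : ℝ) ^ c₃ * g n := mul_le_mul_of_nonneg_left (ih (by omega)) h0
      _ ≤ g (n + 1) := by simpa using H.lower (n + 1) (by omega) h

/-- If g 0 vanished, the upper recursion would make every g s nonpositive, contradicting total mass
one. -/
lemma IsSparsePrior.zero_pos (H : IsSparsePrior p g c₁ c₂ c₃ c₄) : 0 < g 0 := by
  refine (H.nonneg 0 (Nat.zero_le _)).lt_of_ne' fun h0 => ?_
  have h : ∑ s ∈ Finset.range (d + 1), g s ≤ 0 := by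
    refine Finset.sum_nonpos fun s hs => ?_
    have := H.le_pow_mul 0 s (by simpa [Nat.lt_succ_iff] using hs)
    simpa [h0] using this
  rw [H.sum_one] at h
  linarith

lemma IsSparsePrior.pos (H : IsSparsePrior p g c₁ c₂ c₃ c₄) (hd : 0 < d) {s : ℕ} (h : s ≤ d) :
    0 < g s := by
  have h1 := H.c₁_pos
  have h2 : (0 : ℝ) < d := Nat.cast_pos.2 hd
  exact (mul_pos (by positivity) H.zero_pos).trans_le (H.pow_mul_le s h)

lemma IsSparsePrior.weight_nonneg (H : IsSparsePrior p g c₁ c₂ c₃ c₄) (δ : Finset (Fin d)) :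
    0 ≤ p δ := by
  rw [H.weight]
  exact div_nonneg (H.nonneg _ (by simpa using δ.card_le_univ)) (Nat.cast_nonneg _)

/-- Geometric control of the exponentially weighted tails of the prior on the model size. -/
lemma IsSparsePrior.tail_sum_le (H : IsSparsePrior p g c₁ c₂ c₃ c₄) {K : ℝ} (hK : 0 ≤ K)
    (hx : K * (c₂ / (d : ℝ) ^ c₄) ≤ 1 / 2) (s k : ℕ) (hs : s ≤ d) :
    ∑ t ∈ Finset.Ico (s + k) (d + 1), g t * K ^ t ≤
      2 * (g s * K ^ s * (K * (c₂ / (d : ℝ) ^ c₄)) ^ k) := by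
  set x := c₂ / (d : ℝ) ^ c₄ with hxdef
  have hx0 : 0 ≤ x := H.ratio_nonneg
  have hg := H.nonneg s hs
  rw [Finset.sum_Ico_eq_sum_range]
  calc ∑ i ∈ Finset.range (d + 1 - (s + k)), g (s + k + i) * K ^ (s + k + i)
      ≤ ∑ i ∈ Finset.range (d + 1 - (s + k)), g s * K ^ s * (K * x) ^ k * (1 / 2) ^ i := by
        refine Finset.sum_le_sum fun i hi => ?_
        have hi' : s + (k + i) ≤ d := by
          have := Finset.mem_range.1 hi
          omega
        calc g (s + k + i) * K ^ (s + k + i) = g (s + (k + i)) * K ^ (s + (k + i)) := by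
              rw [add_assoc]
          _ ≤ (x ^ (k + i) * g s) * K ^ (s + (k + i)) :=
              mul_le_mul_of_nonneg_right (H.le_pow_mul s (k + i) hi') (by positivity)
          _ = g s * K ^ s * (K * x) ^ k * (K * x) ^ i := by
              rw [mul_pow, mul_pow, pow_add, pow_add, pow_add]; ring
          _ ≤ g s * K ^ s * (K * x) ^ k * (1 / 2) ^ i := by gcongr
    _ = g s * K ^ s * (K * x) ^ k * ∑ i ∈ Finset.range (d + 1 - (s + k)), (1 / 2 : ℝ) ^ i := by
        rw [Finset.mul_sum]
    _ ≤ g s * K ^ s * (K * x) ^ k * 2 := by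
        gcongr
        exact sum_geometric_two_le _
    _ = _ := by ring

/-- The number of models of size t cancels the binomial in the weight. The indicator records that
only models with at least m active coordinates matter. -/
lemma IsSparsePrior.sum_weight (H : IsSparsePrior p g c₁ c₂ c₃ c₄) (K : ℝ) (m : ℕ) :
    ∑ δ : Finset (Fin d), p δ * (if m ≤ δ.card then K ^ δ.card else 0) =
      ∑ t ∈ Finset.Ico m (d + 1), g t * K ^ t := by
  simp_rw [H.weight]
  rw [← Finset.powerset_univ, Finset.sum_powerset_apply_card
    (fun t => g t / (d.choose t : ℝ) * (if m ≤ t then K ^ t else 0))]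
  have hI : Finset.Ico m (d + 1) = (Finset.range (d + 1)).filter fun t => m ≤ t := by
    ext t; simp [and_comm]
  rw [hI, Finset.sum_filter, Finset.card_univ, Fintype.card_fin]
  refine Finset.sum_congr rfl fun t ht => ?_
  have : (d.choose t : ℝ) ≠ 0 := by
    exact_mod_cast (Nat.choose_pos (by simpa [Nat.lt_succ_iff] using ht)).ne'
  split_ifs
  · rw [nsmul_eq_mul]; field_simp
  · simp

end Weights

/-! ### Bounds on the quasi-posterior -/

lemma setLIntegral_prior (p : Finset (Fin d) → ℝ) (ρ : ℝ) (A : Set (Param d))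
    (F : Param d → ℝ≥0∞) :
    ∫⁻ θ in A, F θ ∂prior p ρ = ∑ δ, ENNReal.ofReal (p δ) * ∫⁻ θ in A, F θ ∂condPrior ρ δ := by
  have h : (prior p ρ).restrict A =
      ∑ δ : Finset (Fin d), ENNReal.ofReal (p δ) • (condPrior ρ δ).restrict A := by
    rw [prior, ← Measure.restrictₗ_apply, map_sum]
    simp
  rw [h, lintegral_finsetSum_measure]
  simp_rw [lintegral_smul_measure, smul_eq_mul]

lemma isFiniteMeasure_prior (p : Finset (Fin d) → ℝ) {ρ : ℝ} (hρ : 0 < ρ) :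
    IsFiniteMeasure (prior p ρ) := by
  constructor
  have h := setLIntegral_prior p ρ Set.univ 1
  simp only [Measure.restrict_univ, Pi.one_apply, lintegral_one] at h
  rw [h, ENNReal.sum_lt_top]
  intro δ _
  have := isProbabilityMeasure_condPrior hρ δ
  simp

lemma measurable_l1 : Measurable (l1 : Param d → ℝ) := by
  unfold l1
  fun_prop

lemma eq_mul_exp_bregman {q : Param d → X → ℝ} (hq : ∀ θ z, 0 < q θ z) (θs θ : Param d) (z : X) :
    q θ z = q θs z * Real.exp (inner ℝ (score q θs z) (θ - θs) + bregman q θs θ z) := by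
  have : inner ℝ (score q θs z) (θ - θs) + bregman q θs θ z =
      Real.log (q θ z) - Real.log (q θs z) := by
    rw [bregman]; ring
  rw [this, Real.exp_sub, Real.exp_log (hq _ _), Real.exp_log (hq _ _)]
  field_simp [(hq θs z).ne']

/-- One term of the mixture is enough: almost surely under the model of θ⋆, θ - θ⋆ lies in the cone
where the lower curvature bound holds. -/
lemma le_normalizer {q : Param d → X → ℝ} (hq : ∀ θ z, 0 < q θ z)
    {p : Finset (Fin d) → ℝ} {ρ L : ℝ} (hρ : 0 < ρ) (hL : 0 ≤ L) (θs : Param d) {z : X}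
    (hz : z ∈ eventLower q θs (starCone θs) L) :
    ENNReal.ofReal (p (sparsity θs)) *
      ENNReal.ofReal (q θs z * (Real.exp (-ρ * l1 θs) * (1 + L / ρ ^ 2)⁻¹ ^ l0 θs)) ≤
      ∫⁻ θ, ENNReal.ofReal (q θ z) ∂prior p ρ := by
  have h := setLIntegral_prior p ρ Set.univ fun θ => ENNReal.ofReal (q θ z)
  simp only [Measure.restrict_univ] at h
  rw [h]
  refine le_trans ?_ (Finset.single_le_sum (fun _ _ => zero_le) (Finset.mem_univ (sparsity θs)))
  gcongr
  rw [ENNReal.ofReal_mul (hq _ _).le]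
  refine (mul_le_mul_right (le_lintegral_condPrior_gaussian hρ hL (score q θs z) θs) _).trans ?_
  rw [← lintegral_const_mul' _ _ ENNReal.ofReal_ne_top]
  refine lintegral_mono_ae ?_
  filter_upwards [ae_condPrior_eq_zero hρ (sparsity θs)] with θ hθ
  have hv : θ - θs ∈ starCone θs := by
    intro j hj
    have := hθ j (by simp [sparsity, hj])
    simp [this, hj]
  have hb := hz _ hv
  rw [add_sub_cancel] at hb
  rw [← ENNReal.ofReal_mul (hq _ _).le, eq_mul_exp_bregman hq θs θ z]
  refine ENNReal.ofReal_le_ofReal (mul_le_mul_of_nonneg_left ?_ (hq _ _).le)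
  refine Real.exp_le_exp.2 ?_
  linarith

/-- A pointwise bound of the quasi-likelihood ratio on a set of parameters with at least `m`
nonzero coordinates gives a bound on the quasi-posterior mass of that set. -/
lemma quasiPosterior_le {q : Param d → X → ℝ} (hq : ∀ θ z, 0 < q θ z)
    {p : Finset (Fin d) → ℝ} {g : ℕ → ℝ} {c₁ c₂ c₃ c₄ : ℝ}
    (H : IsSparsePrior p g c₁ c₂ c₃ c₄) (hd : 0 < d)
    {ρ L κ : ℝ} (hρ : 0 < ρ) (hL : 0 ≤ L) (hκ : 0 < κ) (θs : Param d) {z : X}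
    (hz : z ∈ eventLower q θs (starCone θs) L) {A : Set (Param d)} {m : ℕ}
    (hm : ∀ θ ∈ A, m ≤ l0 θ) (B : ℝ≥0∞)
    (hB : ∀ θ ∈ A, ENNReal.ofReal (q θ z) ≤ ENNReal.ofReal (q θs z * Real.exp (-ρ * l1 θs)) * B *
      ENNReal.ofReal (Real.exp (ρ * l1 θ - κ * ρ * l1 (θ - θs)))) :
    quasiPosterior (prior p ρ) q z A ≤ B * ENNReal.ofReal
      ((d.choose (l0 θs) : ℝ) / g (l0 θs) * (1 + L / ρ ^ 2) ^ l0 θs *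
        ∑ t ∈ Finset.Ico m (d + 1), g t * κ⁻¹ ^ t) := by
  -- Finiteness is what lets `withDensity_apply'` be used on a set A not assumed measurable.
  have := isFiniteMeasure_prior p hρ
  have hs : l0 θs ≤ d := by simpa [l0] using (sparsity θs).card_le_univ
  have hgs := H.pos hd hs
  have hC : (0 : ℝ) < d.choose (l0 θs) := by exact_mod_cast Nat.choose_pos hs
  set c := ENNReal.ofReal (q θs z * Real.exp (-ρ * l1 θs)) with hc
  set T := ∑ t ∈ Finset.Ico m (d + 1), g t * κ⁻¹ ^ t with hT
  rw [quasiPosterior, Measure.smul_apply, withDensity_apply', smul_eq_mul, mul_comm,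
    ← div_eq_mul_inv]
  refine ENNReal.div_le_of_le_mul ?_
  have hnum : ∫⁻ θ in A, ENNReal.ofReal (q θ z) ∂prior p ρ ≤ c * B * ENNReal.ofReal T := by
    rw [setLIntegral_prior, hT, ← H.sum_weight,
      ENNReal.ofReal_sum_of_nonneg fun δ _ => mul_nonneg (H.weight_nonneg δ)
        (by split_ifs <;> positivity), Finset.mul_sum]
    refine Finset.sum_le_sum fun δ _ => ?_
    rw [ENNReal.ofReal_mul (H.weight_nonneg δ), mul_left_comm]
    gcongr
    split_ifs with hδ
    · calc ∫⁻ θ in A, ENNReal.ofReal (q θ z) ∂condPrior ρ δ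
          ≤ ∫⁻ θ in A, c * B * ENNReal.ofReal (Real.exp (ρ * l1 θ - κ * ρ * l1 (θ - θs)))
              ∂condPrior ρ δ := by
            refine setLIntegral_mono ?_ hB
            have := measurable_l1 (d := d)
            fun_prop
        _ ≤ ∫⁻ θ, c * B * ENNReal.ofReal (Real.exp (ρ * l1 θ - κ * ρ * l1 (θ - θs)))
              ∂condPrior ρ δ := setLIntegral_le_lintegral _ _
        _ = c * B * ∫⁻ θ, ENNReal.ofReal (Real.exp (ρ * l1 θ - κ * ρ * l1 (θ - θs)))
              ∂condPrior ρ δ := by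
            rw [lintegral_const_mul]
            have := measurable_l1 (d := d)
            fun_prop
        _ ≤ _ := by
            gcongr
            exact lintegral_condPrior_exp_le hρ hκ δ θs
    -- A model with fewer than m active coordinates gives A no mass.
    · have hA : condPrior ρ δ A = 0 := by
        refine measure_mono_null ?_ (ae_iff.1 (ae_condPrior_eq_zero hρ δ))
        intro θ hθ h
        exact hδ ((hm θ hθ).trans (l0_le_card_of_ae h))
      rw [setLIntegral_measure_zero _ _ hA]
      exact zero_le
  refine hnum.trans (le_trans (le_of_eq ?_) (mul_le_mul_right
    (le_normalizer hq (p := p) hρ hL θs hz) _))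
  have hT0 : 0 ≤ T := Finset.sum_nonneg fun t ht =>
    mul_nonneg (H.nonneg t (by have := (Finset.mem_Ico.1 ht).2; omega)) (by positivity)
  have hqs := hq θs z
  rw [hc, mul_comm _ B, mul_assoc B, mul_assoc B, H.weight,
    show (sparsity θs).card = l0 θs from rfl, ← ENNReal.ofReal_mul (by positivity),
    ← ENNReal.ofReal_mul (by positivity), ← ENNReal.ofReal_mul (by positivity)]
  congr 2
  have h1 : (1 + L / ρ ^ 2) ≠ 0 := by positivity
  rw [inv_pow]
  field_simp

/-- Concavity of `log q` makes the Bregman term nonpositive. -/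
lemma bregman_nonpos {q : Param d → X → ℝ} (H : IsLogConcaveSmooth q) (θs θ : Param d) (z : X) :
    bregman q θs θ z ≤ 0 := by
  obtain ⟨hc, hdiff⟩ := H z
  set F : Param d → ℝ := fun θ => Real.log (q θ z) with hF
  set φ : ℝ → ℝ := F ∘ AffineMap.lineMap θs θ with hφ
  have hφc : ConcaveOn ℝ Set.univ φ := by
    exact hc.comp_affineMap (AffineMap.lineMap (k := ℝ) θs θ)
  have hφd : HasDerivAt φ (inner ℝ (score q θs z) (θ - θs)) 0 := by
    have hg : HasFDerivAt F (InnerProductSpace.toDual ℝ (Param d) (score q θs z))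
        (AffineMap.lineMap (k := ℝ) θs θ 0) := by
      rw [AffineMap.lineMap_apply_zero]
      exact (hdiff θs).hasGradientAt.hasFDerivAt
    simpa using hg.comp_hasDerivAt 0 (AffineMap.hasDerivAt_lineMap (a := θs) (b := θ))
  -- Along the segment from θ⋆ to θ, the slope over [0, 1] is at most the derivative at 0.
  have h := hφc.slope_le_of_hasDerivAt (Set.mem_univ 0) (Set.mem_univ 1) one_pos hφd
  simp only [slope_def_field, hφ, Function.comp_apply, AffineMap.lineMap_apply_one, AffineMap.lineMap_apply_zero,
    sub_zero, div_one] at h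
  simp only [bregman]
  linarith

/-- Expectations of quantities bounded by `1`, and by `B` on an event. -/
lemma lintegral_le_compl_add [MeasurableSpace X] (P : Measure X) [IsProbabilityMeasure P]
    {F : X → ℝ≥0∞} (hF : ∀ z, F z ≤ 1) {E : Set X} {B : ℝ≥0∞} (hB : ∀ z ∈ E, F z ≤ B) :
    ∫⁻ z, F z ∂P ≤ P Eᶜ + B := by
  -- E may fail to be measurable; its complement is enlarged to a measurable set of the same
  -- measure.
  set T := toMeasurable P Eᶜ with hT
  have hTm : MeasurableSet T := measurableSet_toMeasurable _ _
  calc ∫⁻ z, F z ∂P ≤ ∫⁻ z, (T.indicator 1 z + B) ∂P := by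
        refine lintegral_mono fun z => ?_
        by_cases hz : z ∈ E
        · exact (hB z hz).trans le_add_self
        · have : z ∈ T := subset_toMeasurable P _ hz
          simpa [this] using (hF z).trans le_self_add
    _ = P Eᶜ + B := by
        rw [lintegral_add_right _ measurable_const, lintegral_indicator_one hTm,
          measure_toMeasurable, lintegral_const, measure_univ, mul_one]

lemma quasiPosterior_le_one (Pr : Measure (Param d)) (q : Param d → X → ℝ) (z : X)
    (A : Set (Param d)) : quasiPosterior Pr q z A ≤ 1 := by
  refine (measure_mono (Set.subset_univ A)).trans ?_
  rw [quasiPosterior, Measure.smul_apply, withDensity_apply _ MeasurableSet.univ,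
    Measure.restrict_univ, smul_eq_mul]
  exact ENNReal.inv_mul_le_one _

lemma isProbabilityMeasure_law [MeasurableSpace X] {ν : Measure X} {f : Param d → X → ℝ}
    (hf : IsDensityFamily ν f) (θ : Param d) : IsProbabilityMeasure (law ν f θ) :=
  ⟨by rw [law, withDensity_apply _ MeasurableSet.univ, Measure.restrict_univ, (hf θ).2.2]⟩

/-! ### Pointwise bounds on the quasi-likelihood ratio -/

/-- Turns an inequality of exponents into the pointwise hypothesis of `quasiPosterior_le`. B is
extended-valued so that it can be e^a with a = +∞, or a divergent series. -/
lemma ofReal_likelihood_le {q : Param d → X → ℝ} (hq : ∀ θ z, 0 < q θ z) {ρ κ b : ℝ}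
    {θs θ : Param d} {z : X} {B : ℝ≥0∞} (hbB : ENNReal.ofReal (Real.exp b) ≤ B)
    (h : inner ℝ (score q θs z) (θ - θs) + bregman q θs θ z ≤
      -ρ * l1 θs + b + (ρ * l1 θ - κ * ρ * l1 (θ - θs))) :
    ENNReal.ofReal (q θ z) ≤ ENNReal.ofReal (q θs z * Real.exp (-ρ * l1 θs)) * B *
      ENNReal.ofReal (Real.exp (ρ * l1 θ - κ * ρ * l1 (θ - θs))) := by
  have hqs := hq θs z
  refine le_trans ?_ (mul_le_mul_left (mul_le_mul_right hbB _) _)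
  rw [← ENNReal.ofReal_mul (by positivity), ← ENNReal.ofReal_mul (by positivity), mul_assoc,
    mul_assoc, ← mul_assoc (Real.exp _), ← Real.exp_add, ← Real.exp_add,
    eq_mul_exp_bregman hq θs θ z]
  gcongr

lemma l1_nonneg (θ : Param d) : 0 ≤ l1 θ := Finset.sum_nonneg fun _ _ => abs_nonneg _

lemma l1_le_add_l1_sub (θs θ : Param d) : l1 θs ≤ l1 θ + l1 (θ - θs) := by
  simp only [l1, ← Finset.sum_add_distrib]
  refine Finset.sum_le_sum fun j _ => ?_
  rw [PiLp.sub_apply]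
  have := abs_sub_abs_le_abs_sub (θs j) (θ j)
  rw [abs_sub_comm] at this
  linarith

lemma l1_eq_sum_sparsity_add (θs v : Param d) :
    l1 v = ∑ j ∈ sparsity θs, |v j| + ∑ j ∈ (sparsity θs)ᶜ, |v j| :=
  (Finset.sum_add_sum_compl _ _).symm

/-- The triangle inequality on the support of θ⋆; off it, the coordinates of θ and θ - θ⋆ coincide.
-/
lemma l1_sub_l1_le (θs θ : Param d) :
    l1 θs - l1 θ ≤ ∑ j ∈ sparsity θs, |(θ - θs) j| - ∑ j ∈ (sparsity θs)ᶜ, |(θ - θs) j| := by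
  rw [l1_eq_sum_sparsity_add θs θs, l1_eq_sum_sparsity_add θs θ]
  have h1 : ∑ j ∈ sparsity θs, |θs j| ≤
      ∑ j ∈ sparsity θs, |θ j| + ∑ j ∈ sparsity θs, |(θ - θs) j| := by
    rw [← Finset.sum_add_distrib]
    refine Finset.sum_le_sum fun j _ => ?_
    rw [PiLp.sub_apply]
    have := abs_sub_abs_le_abs_sub (θs j) (θ j)
    rw [abs_sub_comm] at this
    linarith
  have h0 : ∀ j ∈ (sparsity θs)ᶜ, θs j = 0 := fun j hj => by simpa [sparsity] using hj
  have h2 : ∑ j ∈ (sparsity θs)ᶜ, |θs j| = 0 :=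
    Finset.sum_eq_zero fun j hj => by rw [h0 j hj, abs_zero]
  have h3 : ∑ j ∈ (sparsity θs)ᶜ, |(θ - θs) j| = ∑ j ∈ (sparsity θs)ᶜ, |θ j| :=
    Finset.sum_congr rfl fun j hj => by rw [PiLp.sub_apply, h0 j hj, sub_zero]
  linarith

lemma sum_sparsity_abs_le (θs v : Param d) :
    ∑ j ∈ sparsity θs, |v j| ≤ Real.sqrt (l0 θs) * ‖v‖ := by
  refine abs_le_of_sq_le_sq' ?_ (by positivity) |>.2
  rw [mul_pow, Real.sq_sqrt (Nat.cast_nonneg _), EuclideanSpace.real_norm_sq_eq]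
  refine sq_sum_le_card_mul_sum_sq.trans ?_
  simp_rw [sq_abs]
  rw [l0]
  gcongr
  exact Finset.subset_univ _

lemma inner_le_of_sup_le {b v : Param d} {c : ℝ} (h : ∀ j, |b j| ≤ c) : inner ℝ b v ≤ c * l1 v := by
  rw [PiLp.inner_apply, l1, Finset.mul_sum]
  refine Finset.sum_le_sum fun j _ => ?_
  calc inner ℝ (b j) (v j) = b j * v j := by simp [mul_comm]
    _ ≤ |b j| * |v j| := by rw [← abs_mul]; exact le_abs_self _
    _ ≤ c * |v j| := by gcongr; exact h j

lemma coe_le_expoA {θs : Param d} (hN : (coneN θs).Nonempty) (ρ : ℝ) (r : ℝ → ℝ) {x : ℝ}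
    (hx : 0 < x) :
    ((-(1 / 2) * (r x - 4 * ρ * Real.sqrt (l0 θs) * x) : ℝ) : EReal) ≤ expoA θs ρ r := by
  rw [expoA, if_pos hN, EReal.coe_mul]
  have h := iInf₂_le (f := fun (x : ℝ) (_ : 0 < x) =>
    ((r x - 4 * ρ * Real.sqrt (l0 θs) * x : ℝ) : EReal)) x hx
  rw [EReal.coe_neg, EReal.neg_mul, EReal.neg_mul, EReal.neg_le_neg_iff]
  exact mul_le_mul_of_nonneg_left h (by norm_num)

/-- Letting x → 0⁺ in the infimum gives a ≥ 0, since r is continuous with r(0) = 0. This makes the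
exponent 0 admissible outside the cone. -/
lemma expoA_nonneg (θs : Param d) (ρ : ℝ) {r : ℝ → ℝ} (hr : IsRateFunction r) :
    0 ≤ expoA θs ρ r := by
  by_cases hN : (coneN θs).Nonempty
  · have ht : Tendsto (fun x => -(1 / 2) * (r x - 4 * ρ * Real.sqrt (l0 θs) * x))
        (𝓝[>] (0 : ℝ)) (𝓝 0) := by
      have h1 : Tendsto r (𝓝[>] (0 : ℝ)) (𝓝 0) := by
        have := (hr.continuousOn 0 Set.self_mem_Ici).mono Set.Ioi_subset_Ici_self
        rw [ContinuousWithinAt, hr.zero] at this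
        exact this
      have h2 : Tendsto (fun x : ℝ => 4 * ρ * Real.sqrt (l0 θs) * x) (𝓝[>] (0 : ℝ)) (𝓝 0) := by
        have : Continuous fun x : ℝ => 4 * ρ * Real.sqrt (l0 θs) * x := by fun_prop
        simpa using (this.tendsto 0).mono_left nhdsWithin_le_nhds
      have h3 := (h1.sub h2).const_mul (-(1 / 2))
      rwa [sub_zero, mul_zero] at h3
    have ht' := (continuous_coe_real_ereal.tendsto 0).comp ht
    refine le_of_tendsto ht' ?_
    filter_upwards [self_mem_nhdsWithin] with x hx
    exact coe_le_expoA hN ρ r hx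
  · rw [expoA, if_neg hN]

/-- The exponent bound behind the sparsity statement. -/
lemma exists_exponent_le {q : Param d → X → ℝ} (H : IsLogConcaveSmooth q) {ρ : ℝ} (hρ : 0 < ρ)
    {r : ℝ → ℝ} (hr : IsRateFunction r) (θs θ : Param d) {z : X} (h0 : z ∈ eventScoreSup q θs ρ)
    (h1 : z ∈ eventUpper q θs (coneN θs) r) :
    ∃ b : ℝ, (b : EReal) ≤ expoA θs ρ r ∧
      inner ℝ (score q θs z) (θ - θs) + bregman q θs θ z ≤
        -ρ * l1 θs + b + (ρ * l1 θ - 1 / 4 * ρ * l1 (θ - θs)) := by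
  set v := θ - θs with hv
  have hin : inner ℝ (score q θs z) v ≤ ρ / 2 * l1 v := inner_le_of_sup_le h0
  set x := ∑ j ∈ sparsity θs, |v j| with hx
  set y := ∑ j ∈ (sparsity θs)ᶜ, |v j| with hy
  have hxy : l1 v = x + y := l1_eq_sum_sparsity_add θs v
  have hx0 : 0 ≤ x := Finset.sum_nonneg fun _ _ => abs_nonneg _
  have hy0 : 0 ≤ y := Finset.sum_nonneg fun _ _ => abs_nonneg _
  have hl : ρ * (l1 θs - l1 θ) ≤ ρ * (x - y) :=
    mul_le_mul_of_nonneg_left (l1_sub_l1_le θs θ) hρ.le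
  rw [hxy] at hin ⊢
  -- Score, prior shift and the κ = 1/4 term add up to ρ(7x - y)/4. Outside the cone this is
  -- nonpositive, whence the constant 7; inside it is at most 2ρx, which Cauchy–Schwarz bounds by
  -- 2ρ√s⋆‖v‖.
  by_cases hvN : v ∈ coneN θs
  · have hvpos : 0 < ‖v‖ := norm_pos_iff.2 hvN.1
    refine ⟨_, coe_le_expoA ⟨v, hvN⟩ ρ r hvpos, ?_⟩
    have hb := h1 v hvN
    rw [hv, add_sub_cancel] at hb
    have hcs : ρ * x ≤ ρ * (Real.sqrt (l0 θs) * ‖v‖) :=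
      mul_le_mul_of_nonneg_left (sum_sparsity_abs_le θs v) hρ.le
    have h2 := mul_nonneg hρ.le hx0
    have h3 := mul_nonneg hρ.le hy0
    rw [← hv] at hb
    linarith
  · refine ⟨0, by simpa using expoA_nonneg θs ρ hr, ?_⟩
    have hb := bregman_nonpos H θs θ z
    have h7 : 7 * x ≤ y := by
      by_cases h : v = 0
      · simp [hx, hy, h]
      · by_contra hlt
        exact hvN ⟨h, (not_le.1 hlt).le⟩
    have h2 := mul_le_mul_of_nonneg_left h7 hρ.le
    linarith

/-- Posterior mass of the non-sparse parameters, on the good event. -/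
lemma quasiPosterior_l0_le {q : Param d → X → ℝ} (hq : ∀ θ z, 0 < q θ z)
    (H1 : IsLogConcaveSmooth q) {p : Finset (Fin d) → ℝ} {g : ℕ → ℝ} {c₁ c₂ c₃ c₄ : ℝ}
    (H2 : IsSparsePrior p g c₁ c₂ c₃ c₄) (hd : 8 * c₂ ≤ (d : ℝ) ^ c₄) {ρ L : ℝ} (hρ : 0 < ρ)
    (hL : 0 ≤ L) {r : ℝ → ℝ} (hr : IsRateFunction r) (θs : Param d) {z : X}
    (h0 : z ∈ eventScoreSup q θs ρ) (h1 : z ∈ eventLower q θs (starCone θs) L)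
    (h2 : z ∈ eventUpper q θs (coneN θs) r) (k : ℕ) :
    quasiPosterior (prior p ρ) q z {θ | l0 θs + k ≤ l0 θ} ≤
      2 * (expoA θs ρ r).exp * ENNReal.ofReal ((4 + 4 * L / ρ ^ 2) ^ l0 θs *
        (d.choose (l0 θs) : ℝ) * (4 * c₂ / (d : ℝ) ^ c₄) ^ k) := by
  have hs : l0 θs ≤ d := by simpa [l0] using (sparsity θs).card_le_univ
  have hgs := H2.pos (H2.dim_pos hd) hs
  refine (quasiPosterior_le hq H2 (H2.dim_pos hd) hρ hL (κ := 1 / 4) (by norm_num) θs h1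
    (m := l0 θs + k) (fun θ hθ => hθ) (expoA θs ρ r).exp fun θ _ => ?_).trans ?_
  · obtain ⟨b, hb, hle⟩ := exists_exponent_le H1 hρ hr θs θ h0 h2
    refine ofReal_likelihood_le hq ?_ hle
    rw [← EReal.exp_coe]
    exact EReal.exp_monotone hb
  · rw [mul_comm 2, mul_assoc (EReal.exp _) 2]
    refine mul_le_mul_right ?_ _
    rw [show (2 : ℝ≥0∞) = ENNReal.ofReal 2 by simp, ← ENNReal.ofReal_mul (by norm_num)]
    refine ENNReal.ofReal_le_ofReal ?_
    -- With K = κ⁻¹ = 4, the assumption d^{c₄} ≥ 8c₂ is exactly the ratio bound 1/2 of the geometric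
    -- tail.
    have hx := H2.ratio_le hd
    have htail := H2.tail_sum_le (K := (1 / 4)⁻¹) (by norm_num) (by norm_num at hx ⊢; linarith)
      (l0 θs) k hs
    refine (mul_le_mul_of_nonneg_left htail (by positivity)).trans (le_of_eq ?_)
    rw [show (4 + 4 * L / ρ ^ 2) = 4 * (1 + L / ρ ^ 2) by ring,
      mul_pow 4 (1 + L / ρ ^ 2),
      show (1 / 4 : ℝ)⁻¹ = 4 by norm_num, mul_div_assoc]
    generalize (1 + L / ρ ^ 2) ^ l0 θs = u
    generalize (4 * (c₂ / (d : ℝ) ^ c₄)) ^ k = w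
    field_simp

/-- Test the score against the standard basis vectors. -/
lemma eventScore_univ_subset (q : Param d → X → ℝ) (θs : Param d) (lam : ℝ) :
    eventScore q θs Set.univ lam ⊆ eventScoreSup q θs lam := by
  intro z hz j
  have h := hz (EuclideanSpace.single j 1) (Set.mem_univ _) (by simp)
  rw [EuclideanSpace.inner_single_right] at h
  simpa using h

/-! ### Contraction -/

/-- Strictly beyond the infimum there is an admissible x below y, so attainment of the infimum is
not needed. -/
lemma mul_le_of_rateInv_lt {r : ℝ → ℝ} {a y : ℝ} (hfin : rateInv r a < ∞)
    (hy : (rateInv r a).toReal < y) : a * y ≤ r y := by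
  have h : rateInv r a < ENNReal.ofReal y := (ENNReal.lt_ofReal_iff_toReal_lt hfin.ne).2 hy
  rw [rateInv] at h
  simp only [iInf_lt_iff] at h
  obtain ⟨x, ⟨hx0, hx⟩, hxy⟩ := h
  exact hx y ((ENNReal.ofReal_lt_ofReal_iff_of_nonneg hx0.le).1 hxy).le

/-- A crude bound suffices: it only serves to apply `le_csSup` to the real supremum. -/
lemma bddAbove_coneConst (Θ : Set (Param d)) :
    BddAbove {t | ∃ u ∈ Θ, ∃ v ∈ Θ, ‖v‖ = 1 ∧ t = |∑ j, Real.sign (u j) * v j|} := by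
  refine ⟨d, ?_⟩
  rintro t ⟨u, -, v, -, hv, rfl⟩
  calc |∑ j, Real.sign (u j) * v j| ≤ ∑ j, |Real.sign (u j) * v j| :=
        Finset.abs_sum_le_sum_abs _ _
    _ ≤ ∑ _j : Fin d, (1 : ℝ) := by
        refine Finset.sum_le_sum fun j _ => ?_
        have h1 : |Real.sign (u j)| ≤ 1 := by
          rcases Real.sign_apply_eq (u j) with h | h | h <;> simp [h]
        have h2 : |v j| ≤ 1 := by
          rw [← hv]; exact PiLp.norm_apply_le v j
        rw [abs_mul]
        exact mul_le_one₀ h1 (abs_nonneg _) h2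
    _ = d := by simp

lemma coneConst_nonneg (Θ : Set (Param d)) : 0 ≤ coneConst Θ := by
  refine Real.sSup_nonneg ?_
  rintro t ⟨u, -, v, -, -, rfl⟩
  exact abs_nonneg _

/-- Taking u = v and the normalized v as competitors, the sign pairing equals ‖v‖₁ / ‖v‖. -/
lemma l1_le_coneConst_mul {Θ : Set (Param d)} (hΘ : IsSplitCone Θ) {v : Param d} (hv : v ∈ Θ)
    (h0 : v ≠ 0) : l1 v ≤ coneConst Θ * ‖v‖ := by
  have hpos : 0 < ‖v‖ := norm_pos_iff.2 h0
  have hmem : |∑ j, Real.sign (v j) * (‖v‖⁻¹ • v) j| ≤ coneConst Θ :=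
    le_csSup (bddAbove_coneConst Θ) ⟨v, hv, ‖v‖⁻¹ • v, hΘ.smul_mem _ (by positivity) v hv,
      norm_smul_inv_norm h0, rfl⟩
  have he : ∑ j, Real.sign (v j) * (‖v‖⁻¹ • v) j = ‖v‖⁻¹ * l1 v := by
    rw [l1, Finset.mul_sum]
    refine Finset.sum_congr rfl fun j _ => ?_
    rw [PiLp.smul_apply, smul_eq_mul, mul_left_comm]
    rcases lt_trichotomy (v j) 0 with h | h | h
    · rw [Real.sign_of_neg h, abs_of_neg h]; ring
    · simp [h]
    · rw [Real.sign_of_pos h, abs_of_pos h]; ring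
  rw [he, abs_of_nonneg (mul_nonneg (by positivity) (l1_nonneg v)), inv_mul_le_iff₀ hpos] at hmem
  linarith

/-- Every radius beyond `R` lies in a shell `(jR, (j+1)R]` with `j ≥ 1`. -/
lemma exists_shell {R x : ℝ} (hR : 0 < R) (hx : R < x) :
    ∃ j : ℕ+, (j : ℝ) * R < x ∧ x ≤ ((j : ℝ) + 1) * R := by
  -- The index is ⌈x/R⌉ - 1, since shells are open on the left and closed on the right.
  have h1 : 1 < ⌈x / R⌉₊ := Nat.lt_ceil.2 (by rw [Nat.cast_one, one_lt_div hR]; exact hx)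
  refine ⟨⟨⌈x / R⌉₊ - 1, by omega⟩, ?_, ?_⟩
  · have : ⌈x / R⌉₊ - 1 < ⌈x / R⌉₊ := by omega
    have := Nat.lt_ceil.1 this
    simpa using (lt_div_iff₀ hR).1 this
  · have := Nat.le_ceil (x / R)
    rw [div_le_iff₀ hR] at this
    rw [PNat.mk_coe, Nat.cast_sub h1.le]
    simpa using this

/-- Posterior mass away from `θs`, on the good event. -/
lemma quasiPosterior_dist_le {q : Param d → X → ℝ} (hq : ∀ θ z, 0 < q θ z)
    {p : Finset (Fin d) → ℝ} {g : ℕ → ℝ} {c₁ c₂ c₃ c₄ : ℝ}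
    (H2 : IsSparsePrior p g c₁ c₂ c₃ c₄) (hd : 8 * c₂ ≤ (d : ℝ) ^ c₄) {ρ L lam : ℝ} (hρ : 0 < ρ)
    (hL : 0 ≤ L) {r : ℝ → ℝ} (hr : IsRateFunction r) {Θ : Set (Param d)} (hΘ : IsSplitCone Θ)
    (θs : Param d) {z : X} (h0 : z ∈ eventScore q θs Θ lam)
    (h1 : z ∈ eventLower q θs (starCone θs) L) (h2 : z ∈ eventUpper q θs Θ r)
    {R : ℝ} (hR : 0 < R) (hrate : ∀ y, R < y → 2 * lam * y ≤ r y) :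
    quasiPosterior (prior p ρ) q z {θ | θ - θs ∈ Θ ∧ R < ‖θ - θs‖} ≤
      ENNReal.ofReal (2 * (d.choose (l0 θs) : ℝ) * ((d : ℝ) ^ c₃ / c₁) ^ l0 θs *
        (1 + L / ρ ^ 2) ^ l0 θs) *
      ∑' j : ℕ+, ENNReal.ofReal (Real.exp (-(1 / 8) * r ((j : ℝ) * R / 2)) *
        Real.exp (3 * ρ * coneConst Θ * ((j : ℝ) * R))) := by
  have hs : l0 θs ≤ d := by simpa [l0] using (sparsity θs).card_le_univ
  have hgs := H2.pos (H2.dim_pos hd) hs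
  have hdp : (0 : ℝ) < d := Nat.cast_pos.2 (H2.dim_pos hd)
  refine (quasiPosterior_le hq H2 (H2.dim_pos hd) hρ hL (κ := 1 / 2) (by norm_num) θs h1
    (m := 0) (fun θ _ => Nat.zero_le _)
    (∑' j : ℕ+, ENNReal.ofReal (Real.exp (-(1 / 8) * r ((j : ℝ) * R / 2)) *
        Real.exp (3 * ρ * coneConst Θ * ((j : ℝ) * R)))) fun θ hθ => ?_).trans ?_
  · obtain ⟨hv, hvR⟩ := hθ
    set v := θ - θs with hvdef
    have hv0 : 0 < ‖v‖ := hR.trans hvR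
    refine ofReal_likelihood_le hq (b := -(1 / 4) * r ‖v‖ + 3 / 2 * ρ * l1 v) ?_ ?_
    · obtain ⟨j, hj1, hj2⟩ := exists_shell hR hvR
      refine le_trans ?_ (ENNReal.le_tsum j)
      rw [← Real.exp_add]
      refine ENNReal.ofReal_le_ofReal (Real.exp_le_exp.2 ?_)
      -- For j ≥ 1 the outer radius (j + 1)R is at most 2jR, so (3/2)ρ‖v‖₁ ≤ 3ρc₀jR. On the rate
      -- side, monotonicity and nonnegativity of r leave room to spare.
      have hj : (1 : ℝ) ≤ j := by exact_mod_cast one_le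
      have hjR : R ≤ j * R := le_mul_of_one_le_left hR.le hj
      have hr1 : r (j * R / 2) ≤ r ‖v‖ :=
        hr.strictMonoOn.monotoneOn (show (0 : ℝ) ≤ j * R / 2 by positivity) hv0.le (by linarith)
      have hr0 : 0 ≤ r (j * R / 2) := by
        rw [← hr.zero]
        exact hr.strictMonoOn.monotoneOn (show (0 : ℝ) ≤ 0 from le_rfl)
          (show (0 : ℝ) ≤ j * R / 2 by positivity) (by positivity)
      have hl : l1 v ≤ coneConst Θ * (2 * (j * R)) :=
        (l1_le_coneConst_mul hΘ hv (norm_pos_iff.1 hv0)).trans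
          (mul_le_mul_of_nonneg_left (by linarith) (coneConst_nonneg Θ))
      have := mul_le_mul_of_nonneg_left hl hρ.le
      linarith
    -- The score contributes at most λ‖v‖/2 ≤ r(‖v‖)/4, so half of the curvature gain r(‖v‖)/2
    -- survives. The prior shift and the κ = 1/2 term together cost (3/2)ρ‖v‖₁.
    · have hb := h2 v hv
      rw [hvdef, add_sub_cancel, ← hvdef] at hb
      have hsc := h0 (‖v‖⁻¹ • v) (hΘ.smul_mem _ (by positivity) v hv)
        (norm_smul_inv_norm (norm_pos_iff.1 hv0))
      rw [inner_smul_right] at hsc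
      have hsc' : ‖v‖⁻¹ * inner ℝ (score q θs z) v ≤ lam / 2 := (le_abs_self _).trans hsc
      rw [inv_mul_le_iff₀ hv0] at hsc'
      have hrv := hrate _ hvR
      have hl := mul_le_mul_of_nonneg_left (l1_le_add_l1_sub θs θ) hρ.le
      rw [← hvdef] at hl
      linarith
  · rw [mul_comm]
    refine mul_le_mul_left (ENNReal.ofReal_le_ofReal ?_) _
    have hx := H2.ratio_le hd
    have htail := H2.tail_sum_le (K := (1 / 2)⁻¹) (by norm_num) (by norm_num at hx ⊢; linarith)
      0 0 (Nat.zero_le _)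
    simp only [add_zero, pow_zero, mul_one] at htail
    -- The numerator sums over all models and is of order g 0, while the normalizer only sees g s⋆;
    -- the lower recursion compares the two.
    have hg0 : g 0 ≤ ((d : ℝ) ^ c₃ / c₁) ^ l0 θs * g (l0 θs) := by
      have h := H2.pow_mul_le _ hs
      have hc := H2.c₁_pos
      rw [← inv_div, inv_pow, inv_mul_le_iff₀ (by positivity)] at h
      exact h
    calc (d.choose (l0 θs) : ℝ) / g (l0 θs) * (1 + L / ρ ^ 2) ^ l0 θs *
          ∑ t ∈ Finset.Ico 0 (d + 1), g t * (1 / 2)⁻¹ ^ t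
        ≤ (d.choose (l0 θs) : ℝ) / g (l0 θs) * (1 + L / ρ ^ 2) ^ l0 θs *
          (2 * (((d : ℝ) ^ c₃ / c₁) ^ l0 θs * g (l0 θs))) := by
          refine mul_le_mul_of_nonneg_left (htail.trans ?_) (by positivity)
          linarith
      _ = _ := by field_simp

end QuasiPosterior

end

theorem theorem1 {d : ℕ} {X : Type*} [MeasurableSpace X]
    (ν : MeasureTheory.Measure X) [MeasureTheory.SigmaFinite ν]
    (f q : QuasiPosterior.Param d → X → ℝ) (θs : QuasiPosterior.Param d)
    (p : Finset (Fin d) → ℝ) (g : ℕ → ℝ) (ρ c₁ c₂ c₃ c₄ : ℝ)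
    (hρ : 0 < ρ)
    (hf : QuasiPosterior.IsDensityFamily ν f)
    (hq : QuasiPosterior.IsQuasiLikelihood ν (QuasiPosterior.prior p ρ) q)
    (H1 : QuasiPosterior.IsLogConcaveSmooth q)
    (H2 : QuasiPosterior.IsSparsePrior p g c₁ c₂ c₃ c₄)
    (hd : 8 * c₂ ≤ (d : ℝ) ^ c₄)
    (Θ : Set (QuasiPosterior.Param d)) (hΘ : QuasiPosterior.IsSplitCone Θ)
    (hΘm : MeasurableSet Θ) (hΘs : QuasiPosterior.starCone θs ⊆ Θ)
    (L lam : ℝ) (hL : 0 ≤ L) (hlam : 0 ≤ lam)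
    (r : ℝ → ℝ) (hr : QuasiPosterior.IsRateFunction r)
    (hfin : QuasiPosterior.rateInv r (2 * lam) < ∞) :
    let P := QuasiPosterior.law ν f θs
    let post := QuasiPosterior.quasiPosterior (QuasiPosterior.prior p ρ) q
    let s := QuasiPosterior.l0 θs
    let ε := (QuasiPosterior.rateInv r (2 * lam)).toReal
    let curv := QuasiPosterior.eventLower q θs (QuasiPosterior.starCone θs) L ∩
      QuasiPosterior.eventUpper q θs (QuasiPosterior.coneN θs) r
    let bound1 : ℕ → ℝ≥0∞ := fun k =>
      2 * (QuasiPosterior.expoA θs ρ r).exp *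
        ENNReal.ofReal ((4 + 4 * L / ρ ^ 2) ^ s * (d.choose s : ℝ) *
          (4 * c₂ / (d : ℝ) ^ c₄) ^ k)
    -- Part (1), with the event `E₀(ℝ^d, ρ)`
    (∀ k : ℕ,
      ∫⁻ z, post z {θ | s + k ≤ QuasiPosterior.l0 θ} ∂P ≤
        P (QuasiPosterior.eventScore q θs Set.univ ρ ∩ curv)ᶜ + bound1 k) ∧
    -- Part (1), with the larger event `{‖∇ log q_{θ⋆}‖_∞ ≤ ρ/2}` in place of `E₀(ℝ^d, ρ)`
    (∀ k : ℕ,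
      ∫⁻ z, post z {θ | s + k ≤ QuasiPosterior.l0 θ} ∂P ≤
        P (QuasiPosterior.eventScoreSup q θs ρ ∩ curv)ᶜ + bound1 k) ∧
    -- Part (2)
    (∀ M : ℝ, 2 < M →
      ∫⁻ z, post z {θ | θ - θs ∈ Θ ∧ M * ε < ‖θ - θs‖} ∂P ≤
        P (QuasiPosterior.eventScore q θs Θ lam ∩
            QuasiPosterior.eventLower q θs (QuasiPosterior.starCone θs) L ∩
            QuasiPosterior.eventUpper q θs Θ r)ᶜ +
        ∑' j : ℕ+,
          (QuasiPosterior.packing ((j : ℝ) * M * ε / 2)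
            (QuasiPosterior.coneBall θs Θ (((j : ℝ) + 1) * M * ε)) : ℝ≥0∞) *
          ENNReal.ofReal (Real.exp (-(1 / 8) * r ((j : ℝ) * M * ε / 2))) +
        ENNReal.ofReal (2 * (d.choose s : ℝ) * ((d : ℝ) ^ c₃ / c₁) ^ s * (1 + L / ρ ^ 2) ^ s) *
          ∑' j : ℕ+,
            ENNReal.ofReal (Real.exp (-(1 / 8) * r ((j : ℝ) * M * ε / 2)) *
              Real.exp (3 * ρ * QuasiPosterior.coneConst Θ * (j : ℝ) * M * ε))) := by
  intro P post s ε curv bound1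
  have hP : MeasureTheory.IsProbabilityMeasure P := QuasiPosterior.isProbabilityMeasure_law hf θs
  -- The version with the larger event is the stronger one; the other follows by comparing
  -- complements.
  have hsup : ∀ k : ℕ, ∫⁻ z, post z {θ | s + k ≤ QuasiPosterior.l0 θ} ∂P ≤
      P (QuasiPosterior.eventScoreSup q θs ρ ∩ curv)ᶜ + bound1 k := fun k =>
    QuasiPosterior.lintegral_le_compl_add P
      (fun z => QuasiPosterior.quasiPosterior_le_one _ q z _) fun z hz =>
        QuasiPosterior.quasiPosterior_l0_le hq.pos H1 H2 hd hρ hL hr θs hz.1 hz.2.1 hz.2.2 k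
  refine ⟨fun k => (hsup k).trans ?_, hsup, fun M hM => ?_⟩
  · gcongr
    exact QuasiPosterior.eventScore_univ_subset q θs ρ
  · have hε0 : 0 ≤ ε := ENNReal.toReal_nonneg
    have hs : s ≤ d := by
      simpa [s, QuasiPosterior.l0] using (QuasiPosterior.sparsity θs).card_le_univ
    have hdp : (0 : ℝ) < d := Nat.cast_pos.2 (H2.dim_pos hd)
    have hc := H2.c₁_pos
    have hC : (0 : ℝ) < d.choose s := by exact_mod_cast Nat.choose_pos hs
    rcases hε0.eq_or_lt with hε | hε
    · -- for `ε = 0` the last series diverges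
      have htop : ∑' j : ℕ+, ENNReal.ofReal (Real.exp (-(1 / 8) * r ((j : ℝ) * M * ε / 2)) *
          Real.exp (3 * ρ * QuasiPosterior.coneConst Θ * (j : ℝ) * M * ε)) = ∞ := by
        simp [← hε, hr.zero]
      rw [htop, ENNReal.mul_top (by rw [ne_eq, ENNReal.ofReal_eq_zero, not_le]; positivity),
        add_top]
      exact le_top
    · have hR : 0 < M * ε := by positivity
      refine (QuasiPosterior.lintegral_le_compl_add P
        (E := QuasiPosterior.eventScore q θs Θ lam ∩
          QuasiPosterior.eventLower q θs (QuasiPosterior.starCone θs) L ∩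
          QuasiPosterior.eventUpper q θs Θ r)
        (fun z => QuasiPosterior.quasiPosterior_le_one _ q z _) fun z hz =>
        QuasiPosterior.quasiPosterior_dist_le hq.pos H2 hd hρ hL hr hΘ θs hz.1.1 hz.1.2 hz.2 hR
          fun y hy => QuasiPosterior.mul_le_of_rateInv_lt hfin ?_).trans ?_
      · have : ε ≤ M * ε := le_mul_of_one_le_left hε.le (by linarith)
        exact this.trans_lt hy
      -- The prior-ratio series alone bounds the mass; the packing series is a nonnegative addition
      -- to the right-hand side.
      · simp only [← mul_assoc]
        gcongr
        exact le_self_add
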